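/- Let $n,m,k\ge 0$ be integers. An embedded simplicial complex $K$ in $\mathbb{R}^n$ is (the union of the simplices of) a finite simplicial complex in $\mathbb{R}^n$. A complex $K'$ is a subdivision of $K$ if each simplex of $K'$ is contained in a simplex of $K$ and each simplex of $K$ is a finite union of simplices of $K'$. For $v\in S^{n-1}$ and $r\in\mathbb{R}$ put $K_{v,r}=\{x\in K : x\cdot v\le r\}$, and let $\mathcal{F}_K(v):\mathbb{R}\to\mathbb{R}$ be the Euler curve $r\mapsto\chi(K_{v,r})$. Here the Euler characteristic of $S\subseteq\mathbb{R}^n$ is $\chi(S)=\sum_{d=0}^{n}(-1)^d k_d$, where $k_d$ is the number of $d$-dimensional cells in a finite partition of $S$ into semialgebraic cells. (The one-point space $\mathbb{R}^0$ is a cell of dimension $0$; over a cell $B\subseteq\mathbb{R}^j$ of dimension $d$, the graph of a continuous semialgebraic function on $B$ is a cell of dimension $d$ in $\mathbb{R}^{j+1}$, and the band $\{(x,t): x\in B,\ f(x)<t<g(x)\}$ is a cell of dimension $d+1$, where $f<g$ on $B$ and each of $f,g$ is a continuous semialgebraic function on $B$ or constantly $\pm\infty$.) Let $\mathcal{D}_1,\dots,\mathcal{D}_m:\operatorname{Map}(\mathbb{R}\to\mathbb{R})\to\mathbb{R}$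 be translation-invariant functionals, that is, $\mathcal{D}_i f=\mathcal{D}_i g$ whenever there is $t\in\mathbb{R}$ with $f(x)=g(x+t)$ for all $x$, and define $$\mathcal{DF}_K:S^{n-1}\to\mathbb{R}^m,\qquad v\mapsto\bigl(\mathcal{D}_1(\mathcal{F}_K(v)),\dots,\mathcal{D}_m(\mathcal{F}_K(v))\bigr).$$ Let $\mathcal{P}:\operatorname{Map}(S^{n-1}\to\mathbb{R}^m)\to\mathbb{R}^k$ be any $\mathrm{O}(n)$-invariant function, that is, $\mathcal{P}(Rf)=\mathcal{P}(f)$ for all $R\in\mathrm{O}(n)$ and all $f$, where $(Rf)(x)=f(Rx)$. Then $\chi(K_{v,r})$ is well defined for all $K$, $v$, $r$ ($K_{v,r}$ has a finite partition into cells, and all such partitions give the same value), and $K\mapsto\mathcal{P}(\mathcal{DF}_K)$ is isometry-invariant and subdivision-invariant on the set of embedded simplicial complexes in $\mathbb{R}^n$: $\mathcal{P}(\mathcal{DF}_{\varphi(K)})=\mathcal{P}(\mathcal{DF}_K)$ for every map $\varphi:\mathbb{R}^n\to\mathbb{R}^n$ with $\|\varphi(x)-\varphi(y)\|=\|x-y\|$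 for all $x,y$, and $\mathcal{P}(\mathcal{DF}_{K'})=\mathcal{P}(\mathcal{DF}_K)$ for every subdivision $K'$ of $K$. -/

import Mathlib

/-- The Euclidean space `ℝⁿ`. -/
abbrev Euc (n : ℕ) : Type := EuclideanSpace ℝ (Fin n)

/-- The unit sphere `S^{n-1}` in `ℝⁿ`. -/
abbrev UnitSphere (n : ℕ) : Type := Metric.sphere (0 : Euc n) 1

/-- Semialgebraic subsets of `ℝⁿ`: finite unions and intersections of sets `{f > 0}` and
`{g = 0}`, with `f`, `g` real polynomials in `n` variables. -/
inductive IsSemialgebraic {n : ℕ} : Set (Fin n → ℝ) → Prop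
  | pos (p : MvPolynomial (Fin n) ℝ) : IsSemialgebraic {x | 0 < MvPolynomial.eval x p}
  | zero (p : MvPolynomial (Fin n) ℝ) : IsSemialgebraic {x | MvPolynomial.eval x p = 0}
  | union {S T : Set (Fin n → ℝ)} :
      IsSemialgebraic S → IsSemialgebraic T → IsSemialgebraic (S ∪ T)
  | inter {S T : Set (Fin n → ℝ)} :
      IsSemialgebraic S → IsSemialgebraic T → IsSemialgebraic (S ∩ T)

/-- The graph `{(x, t) : x ∈ B, t = f x}` in `ℝ^{n+1}` of a function on `B ⊆ ℝⁿ`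
(only the values of `f` on `B` matter). -/
def graphOver {n : ℕ} (B : Set (Fin n → ℝ)) (f : (Fin n → ℝ) → ℝ) : Set (Fin (n + 1) → ℝ) :=
  {x | Fin.init x ∈ B ∧ x (Fin.last n) = f (Fin.init x)}

/-- The band `{(x, t) : x ∈ B, f x < t < g x}` in `ℝ^{n+1}`. -/
def bandOver {n : ℕ} (B : Set (Fin n → ℝ)) (f g : (Fin n → ℝ) → EReal) :
    Set (Fin (n + 1) → ℝ) :=
  {x | Fin.init x ∈ B ∧ f (Fin.init x) < (x (Fin.last n) : EReal) ∧
    (x (Fin.last n) : EReal) < g (Fin.init x)}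

/-- `f` is a continuous semialgebraic function `B → ℝ`. -/
def IsContSemialgebraicOn {n : ℕ} (B : Set (Fin n → ℝ)) (f : (Fin n → ℝ) → ℝ) : Prop :=
  ContinuousOn f B ∧ IsSemialgebraic (graphOver B f)

/-- `f` is, on `B`, a continuous semialgebraic real function or one of the constants `±∞`. -/
def IsCellBoundOn {n : ℕ} (B : Set (Fin n → ℝ)) (f : (Fin n → ℝ) → EReal) : Prop :=
  (∃ φ : (Fin n → ℝ) → ℝ, IsContSemialgebraicOn B φ ∧ ∀ x ∈ B, f x = (φ x : EReal)) ∨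
    (∀ x ∈ B, f x = ⊥) ∨ (∀ x ∈ B, f x = ⊤)

/-- `IsCell n d C`: the set `C ⊆ ℝⁿ` is a (semialgebraic) cell of dimension `d`. The one-point space
`ℝ⁰` is a cell of dimension `0`; over a cell `B ⊆ ℝⁿ` of dimension `d`, the graph of a continuous
semialgebraic function on `B` is a cell of dimension `d`, and the band between two such functions
`f < g` (where `f = -∞` and `g = +∞` are allowed) is a cell of dimension `d + 1`. -/
def IsCell : (n : ℕ) → ℕ → Set (Fin n → ℝ) → Prop
  | 0, d, C => d = 0 ∧ C = Set.univ
  | n + 1, d, C =>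
      (∃ (B : Set (Fin n → ℝ)) (f : (Fin n → ℝ) → ℝ),
        IsCell n d B ∧ IsContSemialgebraicOn B f ∧ C = graphOver B f) ∨
      (∃ (e : ℕ) (B : Set (Fin n → ℝ)) (f g : (Fin n → ℝ) → EReal),
        d = e + 1 ∧ IsCell n e B ∧ IsCellBoundOn B f ∧ IsCellBoundOn B g ∧
          (∀ x ∈ B, f x < g x) ∧ C = bandOver B f g)

/-- A finite partition of `S ⊆ ℝⁿ` into cells. -/
structure CellPartition {n : ℕ} (S : Set (Fin n → ℝ)) where
  cells : Finset (Set (Fin n → ℝ))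
  dim : Set (Fin n → ℝ) → ℕ
  isCell : ∀ C ∈ cells, IsCell n (dim C) C
  disjoint : ∀ C ∈ cells, ∀ C' ∈ cells, C ≠ C' → Disjoint C C'
  union : (⋃ C ∈ cells, C) = S

/-- The alternating sum `k₀ - k₁ + k₂ - ⋯ ± kₙ`, where `k_d` is the number of `d`-dimensional
cells of the partition. -/
def CellPartition.eulerChar {n : ℕ} {S : Set (Fin n → ℝ)} (𝒞 : CellPartition S) : ℤ :=
  ∑ d ∈ Finset.range (n + 1), (-1) ^ d * ((𝒞.cells.filter fun C => 𝒞.dim C = d).card : ℤ)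

open Classical in
/-- The Euler characteristic `χ(S)`: the alternating sum `χ_𝒞(S)` for a finite partition `𝒞` of `S`
into cells (with the default value `0` if there is none). -/
noncomputable def eulerChar {n : ℕ} (S : Set (Fin n → ℝ)) : ℤ :=
  if h : Nonempty (CellPartition S) then h.some.eulerChar else 0

/-- `χ(S)` is well defined: `S` has a finite partition into cells, and all of these give the same
alternating sum `χ(S)`. -/
def EulerCharWellDefined {n : ℕ} (S : Set (Fin n → ℝ)) : Prop :=
  Nonempty (CellPartition S) ∧ ∀ 𝒞 : CellPartition S, 𝒞.eulerChar = eulerChar S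

/-- A finite simplicial complex in `ℝⁿ`. Mathlib's `Geometry.SimplicialComplex` records a simplex
by its (nonempty, affinely independent) vertex set; the simplex is the convex hull of it, and
`K.space` is the union of the simplices. -/
structure EmbeddedComplex (n : ℕ) extends Geometry.SimplicialComplex ℝ (Euc n) where
  finite_faces : faces.Finite

namespace EmbeddedComplex

variable {n : ℕ}

/-- The union of the simplices of `K`. -/
def carrier (K : EmbeddedComplex n) : Set (Euc n) := K.toSimplicialComplex.space

/-- `K'` is a subdivision of `K`: every simplex of `K'` is contained in a simplex of `K`, and every
simplex of `K` is a finite union of simplices of `K'`. -/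
def IsSubdivision (K' K : EmbeddedComplex n) : Prop :=
  (∀ s ∈ K'.faces, ∃ t ∈ K.faces,
    convexHull ℝ (s : Set (Euc n)) ⊆ convexHull ℝ (t : Set (Euc n))) ∧
  (∀ t ∈ K.faces, ∃ A : Finset (Finset (Euc n)), (A : Set (Finset (Euc n))) ⊆ K'.faces ∧
    convexHull ℝ (t : Set (Euc n)) = ⋃ s ∈ A, convexHull ℝ (s : Set (Euc n)))

theorem image_convexHull_of_isometry {f : Euc n → Euc n} (hf : Isometry f) (s : Set (Euc n)) :
    f '' convexHull ℝ s = convexHull ℝ (f '' s) :=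
  hf.affineIsometryOfStrictConvexSpace.toAffineMap.image_convexHull s

open Classical in
/-- The image `f(K)` of a complex under an isometry `f` of `ℝⁿ`: its simplices are the images under
`f` of the simplices of `K`. -/
noncomputable def isometryImage (K : EmbeddedComplex n) (f : Euc n → Euc n) (hf : Isometry f) :
    EmbeddedComplex n where
  faces := (fun s : Finset (Euc n) => s.image f) '' K.faces
  isRelLowerSet_faces := by
    rintro _ ⟨s, hs, rfl⟩
    refine ⟨(K.isRelLowerSet_faces hs).1.image f, ?_⟩
    intro t hts ht
    obtain ⟨u, hus, rfl⟩ := Finset.subset_image_iff.1 hts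
    exact ⟨u, K.down_closed hs hus (Finset.image_nonempty.1 ht), rfl⟩
  indep := by
    rintro _ ⟨s, hs, rfl⟩
    have h := ((K.indep hs).map' hf.affineIsometryOfStrictConvexSpace.toAffineMap
      hf.injective).range
    have hset : Set.range (hf.affineIsometryOfStrictConvexSpace.toAffineMap ∘
        ((↑) : s → Euc n)) = ((s.image f : Finset (Euc n)) : Set (Euc n)) := by
      ext x
      simp
    rw [hset] at h
    exact h
  inter_subset_convexHull := by
    rintro _ _ ⟨s, hs, rfl⟩ ⟨t, ht, rfl⟩
    rw [Finset.coe_image, Finset.coe_image, ← image_convexHull_of_isometry hf,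
      ← image_convexHull_of_isometry hf, ← Set.image_inter hf.injective,
      ← Set.image_inter hf.injective, ← image_convexHull_of_isometry hf]
    exact Set.image_mono (K.inter_subset_convexHull hs ht)
  finite_faces := K.finite_faces.image _

theorem carrier_isometryImage (K : EmbeddedComplex n) (f : Euc n → Euc n) (hf : Isometry f) :
    (K.isometryImage f hf).carrier = f '' K.carrier := by
  classical
  simp only [carrier, Geometry.SimplicialComplex.space, isometryImage, Set.image_iUnion,
    Set.biUnion_image, Finset.coe_image, image_convexHull_of_isometry hf]

/-- The sublevel set `K_{v,r} = {x ∈ K : x ⬝ v ≤ r}`, in coordinates. -/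
def sublevel (K : EmbeddedComplex n) (v : UnitSphere n) (r : ℝ) : Set (Fin n → ℝ) :=
  {x | inner ℝ (WithLp.toLp 2 x : Euc n) (v : Euc n) ≤ r ∧ WithLp.toLp 2 x ∈ K.carrier}

/-- The Euler curve transform `ℱ_K : S^{n-1} → Map(ℝ → ℝ)`, `v ↦ (r ↦ χ(K_{v,r}))`. -/
noncomputable def eulerCurve (K : EmbeddedComplex n) (v : UnitSphere n) : ℝ → ℝ :=
  fun r => (eulerChar (K.sublevel v r) : ℝ)

/-- `𝒟ℱ_K : S^{n-1} → ℝᵐ`, `v ↦ (𝒟₁(ℱ_K(v)), …, 𝒟ₘ(ℱ_K(v)))`. -/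
noncomputable def curveFeatures {m : ℕ} (D : Fin m → (ℝ → ℝ) → ℝ) (K : EmbeddedComplex n) :
    UnitSphere n → (Fin m → ℝ) :=
  fun v i => D i (K.eulerCurve v)

end EmbeddedComplex

/-- A functional on `Map(ℝ → ℝ)` is translation-invariant. -/
def IsTranslationInvariant (D : (ℝ → ℝ) → ℝ) : Prop :=
  ∀ (f g : ℝ → ℝ) (t : ℝ), (∀ x, f x = g (x + t)) → D f = D g

/-- The action `x ↦ R x` of an orthogonal matrix `R` on the unit sphere. -/
noncomputable def orthogonalSphereMap {n : ℕ} (R : Matrix.orthogonalGroup (Fin n) ℝ)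
    (x : UnitSphere n) : UnitSphere n :=
  ⟨Matrix.toEuclideanLin (R : Matrix (Fin n) (Fin n) ℝ) (x : Euc n), by
    have hx : ‖(x : Euc n)‖ = 1 := by simp
    have h : (R : Matrix (Fin n) (Fin n) ℝ).transpose * (R : Matrix (Fin n) (Fin n) ℝ) = 1 :=
      (Matrix.mem_orthogonalGroup_iff' (Fin n) ℝ).1 R.2
    rw [mem_sphere_zero_iff_norm]
    refine Eq.trans ?_ hx
    rw [EuclideanSpace.norm_eq, EuclideanSpace.norm_eq]
    congr 1
    have key : ∀ y : Euc n, ∑ i, ‖y i‖ ^ 2 = dotProduct (WithLp.ofLp y) (WithLp.ofLp y) := by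
      intro y
      simp [dotProduct, sq]
    rw [key, key, Matrix.ofLp_toEuclideanLin_apply, Matrix.dotProduct_mulVec,
      Matrix.vecMul_mulVec, h, Matrix.vecMul_one]⟩

/-- A function `P` on `Map(S^{n-1} → V)` is `O(n)`-invariant: `P(Rf) = P(f)` for all `R ∈ O(n)`,
where `(Rf)(x) = f(Rx)`. -/
def IsOrthogonalInvariant {n : ℕ} {V W : Type*} (P : (UnitSphere n → V) → W) : Prop :=
  ∀ (R : Matrix.orthogonalGroup (Fin n) ℝ) (f : UnitSphere n → V),
    P (fun x => f (orthogonalSphereMap R x)) = P f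

/-- An operator on embedded simplicial complexes in `ℝⁿ` is isometry-invariant. -/
def IsIsometryInvariant {n : ℕ} {W : Type*} (Φ : EmbeddedComplex n → W) : Prop :=
  ∀ (K : EmbeddedComplex n) (f : Euc n → Euc n) (hf : Isometry f),
    Φ (K.isometryImage f hf) = Φ K

/-- An operator on embedded simplicial complexes in `ℝⁿ` is subdivision-invariant. -/
def IsSubdivisionInvariant {n : ℕ} {W : Type*} (Φ : EmbeddedComplex n → W) : Prop :=
  ∀ K K' : EmbeddedComplex n, K'.IsSubdivision K → Φ K' = Φ K

/-! The Euler characteristic extends to a linear functional. On the line, some linear functional on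
all functions `ℝ → ℚ` takes the value 1 on points and -1 on open intervals. Iterating it over the
coordinates gives `eulerIntegral`, whose value on a `d`-cell is `(-1)^d` (`IsCell.eulerIntegral`).
The indicator of a set is the sum of the indicators of the cells in any partition, so all partitions
give the same alternating sum. Sublevel sets of a complex do have partitions, because they are
semilinear and finitely many affine functions can be enlarged to a family whose sign classes are
cells (`exists_superset_isCell_signClass`).

Cells and `eulerIntegral` depend on the coordinates, so invariance under rotations needs an
argument. Nonempty compact convex sets have integral 1 (`eulerIntegral_of_convex_compact`). By
inclusion-exclusion, the value on a union of truncated simplices therefore depends only on which of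
them meet (`eulerIntegral_biUnion_congr`), and an isometry preserves this.

Finally, if `φ x = U x + φ 0`, the height on `φ(K)` in direction `v` is the height on `K` in
direction `U⁻¹ v` plus a constant. Translation invariance of the `𝒟ᵢ` absorbs the constant, and
`O(n)`-invariance of `𝒫` absorbs `U⁻¹`. A subdivision leaves the underlying set unchanged. -/

/-! ### Euler integration on the line -/

open Filter Set in
/-- Some linear functional assigns its limit to every function that is eventually constant
along `F`. -/
theorem exists_linearMap_eventuallyConst (F : Filter ℝ) [F.NeBot] :
    ∃ l : (ℝ → ℚ) →ₗ[ℚ] ℚ, ∀ (h : ℝ → ℚ) (c : ℚ), (∀ᶠ t in F, h t = c) → l h = c := by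
  let N : Submodule ℚ (ℝ → ℚ) :=
    { carrier := {h | ∀ᶠ t in F, h t = 0}
      add_mem' := fun ha hb => by
        filter_upwards [ha, hb] with t h1 h2
        simp [h1, h2]
      zero_mem' := by simp
      smul_mem' := fun c h hh => by
        filter_upwards [hh] with t h1
        simp [h1] }
  have h1 : (1 : ℝ → ℚ) ∉ N := by
    intro h
    have h' : ∀ᶠ t in F, (1 : ℝ → ℚ) t = 0 := h
    simp [‹F.NeBot›.ne] at h'
  -- A functional killing `N` but not the constant 1; dividing by `f 1` normalises it.
  obtain ⟨f, hf, hN⟩ := Submodule.exists_le_ker_of_notMem h1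
  refine ⟨(f 1)⁻¹ • f, fun h c hc => ?_⟩
  have hmem : h - c • (1 : ℝ → ℚ) ∈ N := by
    change ∀ᶠ t in F, (h - c • (1 : ℝ → ℚ)) t = 0
    filter_upwards [hc] with t ht
    simp [ht]
  have h0 : f (h - c • (1 : ℝ → ℚ)) = 0 := hN hmem
  rw [map_sub, map_smul, sub_eq_zero] at h0
  simp only [LinearMap.smul_apply, h0, smul_eq_mul]
  field_simp

/-- The open interval in `ℝ` with endpoints in the extended reals. -/
def realIoo (a b : EReal) : Set ℝ := {t | a < (t : EReal) ∧ (t : EReal) < b}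

open Filter Set Topology in
/-- Integration with respect to the Euler characteristic on the line: a linear functional that is
`1` on points and `-1` on open intervals. -/
theorem exists_lineEulerIntegral :
    ∃ l : (ℝ → ℚ) →ₗ[ℚ] ℚ, (∀ a : ℝ, l (indicator {a} 1) = 1) ∧
      ∀ a b : EReal, a < b → l (indicator (realIoo a b) 1) = -1 := by
  -- The functional is `h ↦ ∑ₜ (h(t) - h(t+)) - h(-∞)`, where `R t` extends the right limit at `t`
  -- and `B` the limit at `-∞`.
  choose R hR using fun t : ℝ => exists_linearMap_eventuallyConst (𝓝[>] t)
  obtain ⟨B, hB⟩ := exists_linearMap_eventuallyConst atBot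
  -- A linear retraction onto the finitely supported functions; it extends the finite sum to `σ`,
  -- defined on all functions.
  obtain ⟨G, hG⟩ := (Finsupp.lcoeFun : (ℝ →₀ ℚ) →ₗ[ℚ] (ℝ → ℚ)).exists_leftInverse_of_injective
    (LinearMap.ker_eq_bot.2 DFunLike.coe_injective)
  have hG' : ∀ g : ℝ →₀ ℚ, G (g : ℝ → ℚ) = g := fun g => congrArg (fun φ => φ g) hG
  let σ : (ℝ → ℚ) →ₗ[ℚ] ℚ := (Finsupp.lsum ℚ fun _ => LinearMap.id) ∘ₗ G
  have hσ : ∀ (a : ℝ) (c : ℚ), σ (Finsupp.single a c) = c := fun a c => by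
    simp [σ, hG']
  let J : (ℝ → ℚ) →ₗ[ℚ] (ℝ → ℚ) := LinearMap.id - LinearMap.pi R
  refine ⟨σ ∘ₗ J - B, fun a => ?_, fun a b hab => ?_⟩
  · have hJ : J (indicator {a} 1) = (Finsupp.single a (1 : ℚ) : ℝ →₀ ℚ) := by
      funext t
      have h0 : R t (indicator {a} 1) = 0 := by
        refine hR t _ _ ?_
        rcases lt_or_ge t a with h | h
        · filter_upwards [Ioo_mem_nhdsGT h] with s hs
          exact indicator_of_notMem (s := {a}) hs.2.ne _
        · filter_upwards [self_mem_nhdsWithin] with s hs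
          exact indicator_of_notMem (s := {a}) (h.trans_lt hs).ne' _
      simp only [J, LinearMap.sub_apply, LinearMap.id_apply, LinearMap.pi_apply, Pi.sub_apply, h0]
      simp [Finsupp.single_apply, Pi.single_apply, eq_comm]
    have h0 : B (indicator {a} 1) = 0 := by
      refine hB _ _ ?_
      filter_upwards [eventually_lt_atBot a] with s hs
      exact indicator_of_notMem (s := {a}) hs.ne _
    rw [LinearMap.sub_apply, LinearMap.comp_apply, hJ, h0, hσ, sub_zero]
  -- Right limits turn the open interval into the half-open one, so the only jump is at a finite
  -- left endpoint.
  · have key : ∀ t : ℝ, R t (indicator (realIoo a b) 1) =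
        indicator {t : ℝ | a ≤ t ∧ (t : EReal) < b} 1 t := by
      intro t
      refine hR t _ _ ?_
      by_cases h : a ≤ t ∧ (t : EReal) < b
      · rw [indicator_of_mem (by exact h)]
        obtain ⟨c, hc, hcb⟩ := EReal.lt_iff_exists_real_btwn.1 h.2
        filter_upwards [Ioo_mem_nhdsGT (EReal.coe_lt_coe_iff.1 hc)] with s hs
        exact indicator_of_mem (show s ∈ realIoo a b from
          ⟨h.1.trans_lt (EReal.coe_lt_coe_iff.2 hs.1), (EReal.coe_lt_coe_iff.2 hs.2).trans hcb⟩) _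
      · rw [indicator_of_notMem (by exact h)]
        rw [not_and_or, not_le, not_lt] at h
        rcases h with h | h
        · obtain ⟨c, hc, hcb⟩ := EReal.lt_iff_exists_real_btwn.1 h
          filter_upwards [Ioo_mem_nhdsGT (EReal.coe_lt_coe_iff.1 hc)] with s hs
          exact indicator_of_notMem (fun h' => lt_asymm h'.1
            ((EReal.coe_lt_coe_iff.2 hs.2).trans hcb)) _
        · filter_upwards [self_mem_nhdsWithin] with s hs
          exact indicator_of_notMem (fun h' => lt_asymm h'.2
            (h.trans_lt (EReal.coe_lt_coe_iff.2 hs))) _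
    -- Without a finite left endpoint there is no jump, and the value -1 comes from the term at
    -- `-∞`.
    rcases eq_or_ne a ⊥ with rfl | ha
    · have hJ : J (indicator (realIoo ⊥ b) 1) = 0 := by
        funext t
        simp only [J, LinearMap.sub_apply, LinearMap.id_apply, LinearMap.pi_apply, Pi.sub_apply, key]
        simp [indicator, realIoo]
      have h0 : B (indicator (realIoo ⊥ b) 1) = 1 := by
        refine hB _ _ ?_
        obtain ⟨c, -, hcb⟩ := EReal.lt_iff_exists_real_btwn.1 hab
        filter_upwards [eventually_lt_atBot c] with s hs
        exact indicator_of_mem (show s ∈ realIoo ⊥ b from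
          ⟨EReal.bot_lt_coe s, (EReal.coe_lt_coe_iff.2 hs).trans hcb⟩) _
      simp [hJ, h0]
    · lift a to ℝ using ⟨hab.ne_top, ha⟩
      have hJ : J (indicator (realIoo a b) 1) = (Finsupp.single a (-1 : ℚ) : ℝ →₀ ℚ) := by
        funext t
        simp only [J, LinearMap.sub_apply, LinearMap.id_apply, LinearMap.pi_apply, Pi.sub_apply,
          key, Finsupp.single_apply]
        rcases lt_trichotomy a t with h | rfl | h
        · simp [indicator, realIoo, h, h.le, h.ne]
        · simp [indicator, realIoo, hab]
        · simp [indicator, realIoo, h.not_ge, h.not_gt, h.ne']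
      have h0 : B (indicator (realIoo a b) 1) = 0 := by
        refine hB _ _ ?_
        filter_upwards [eventually_lt_atBot a] with s hs
        exact indicator_of_notMem (fun h => lt_asymm h.1 (EReal.coe_lt_coe_iff.2 hs)) _
      simp [hJ, h0, hσ]

/-- A choice of Euler integral on the line. -/
noncomputable def lineEulerIntegral : (ℝ → ℚ) →ₗ[ℚ] ℚ := exists_lineEulerIntegral.choose

theorem lineEulerIntegral_singleton (a : ℝ) :
    lineEulerIntegral (Set.indicator {a} 1) = 1 :=
  exists_lineEulerIntegral.choose_spec.1 a

theorem lineEulerIntegral_Ioo {a b : EReal} (hab : a < b) :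
    lineEulerIntegral (Set.indicator (realIoo a b) 1) = -1 :=
  exists_lineEulerIntegral.choose_spec.2 a b hab

open Set in
theorem lineEulerIntegral_Icc {a b : ℝ} (hab : a ≤ b) :
    lineEulerIntegral (indicator (Icc a b) 1) = 1 := by
  rcases hab.eq_or_lt with rfl | h
  · rw [Icc_self, lineEulerIntegral_singleton]
  · have hsum : (indicator (Icc a b) 1 : ℝ → ℚ) =
        indicator {a} 1 + indicator (realIoo a b) 1 + indicator {b} 1 := by
      funext t
      simp only [Pi.add_apply, indicator, mem_Icc, realIoo, mem_ofPred_eq, mem_singleton_iff,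
        EReal.coe_lt_coe_iff, Pi.one_apply]
      grind
    rw [hsum, map_add, map_add, lineEulerIntegral_singleton, lineEulerIntegral_singleton,
      lineEulerIntegral_Ioo (EReal.coe_lt_coe_iff.2 h)]
    norm_num

/-! ### Euler integration on `ℝⁿ` -/

/-- The fibre `{t | (x, t) ∈ S}` of a set `S ⊆ ℝ^{n+1}`. -/
def fibre {n : ℕ} (S : Set (Fin (n + 1) → ℝ)) (x : Fin n → ℝ) : Set ℝ :=
  {t | (Fin.snoc x t : Fin (n + 1) → ℝ) ∈ S}

/-- Integration with respect to the Euler characteristic on `ℝⁿ`, one coordinate at a time. -/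
noncomputable def eulerIntegral : (n : ℕ) → ((Fin n → ℝ) → ℚ) →ₗ[ℚ] ℚ
  | 0 => LinearMap.proj 0
  | n + 1 => eulerIntegral n ∘ₗ LinearMap.pi fun x =>
      lineEulerIntegral ∘ₗ LinearMap.funLeft ℚ ℚ fun t : ℝ => (Fin.snoc x t : Fin (n + 1) → ℝ)

open Set in
theorem eulerIntegral_succ {n : ℕ} (S : Set (Fin (n + 1) → ℝ)) :
    eulerIntegral (n + 1) (indicator S 1) =
      eulerIntegral n fun x => lineEulerIntegral (indicator (fibre S x) 1) := rfl

open Set in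
/-- If all the nonempty fibres of `S` have Euler characteristic `c`, then the Euler integral of `S`
is `c` times that of its projection `B`. -/
theorem eulerIntegral_succ_of_fibre {n : ℕ} {S : Set (Fin (n + 1) → ℝ)} {B : Set (Fin n → ℝ)}
    {c : ℚ} (hB : ∀ x ∈ B, lineEulerIntegral (indicator (fibre S x) 1) = c)
    (hB' : ∀ x ∉ B, fibre S x = ∅) :
    eulerIntegral (n + 1) (indicator S 1) = c * eulerIntegral n (indicator B 1) := by
  rw [eulerIntegral_succ, ← smul_eq_mul, ← map_smul]
  congr 1
  funext x
  by_cases hx : x ∈ B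
  · simp [hx, hB x hx]
  · rw [hB' x hx, indicator_empty, Pi.smul_apply, indicator_of_notMem hx, smul_zero]
    exact map_zero _

theorem IsCell.dim_le {n d : ℕ} {C : Set (Fin n → ℝ)} (h : IsCell n d C) : d ≤ n := by
  induction n generalizing d with
  | zero => exact h.1.le
  | succ n ih =>
    rcases h with ⟨B, f, hB, -⟩ | ⟨e, B, f, g, rfl, hB, -⟩
    · exact (ih hB).trans n.le_succ
    · exact Nat.succ_le_succ (ih hB)

-- Fibres of a graph are points and fibres of a band are open intervals, so each coordinate
-- contributes a factor 1 or -1.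
open Set in
theorem IsCell.eulerIntegral {n d : ℕ} {C : Set (Fin n → ℝ)} (h : IsCell n d C) :
    eulerIntegral n (indicator C 1) = (-1) ^ d := by
  induction n generalizing d with
  | zero =>
    obtain ⟨rfl, rfl⟩ := h
    simp [_root_.eulerIntegral]
  | succ n ih =>
    rcases h with ⟨B, f, hB, -, rfl⟩ | ⟨e, B, f, g, rfl, hB, -, -, hfg, rfl⟩
    · rw [eulerIntegral_succ_of_fibre (B := B) (c := 1), ih hB, one_mul]
      · intro x hx
        have : fibre (graphOver B f) x = {f x} := by
          ext t
          simp [fibre, graphOver, hx]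
        rw [this, lineEulerIntegral_singleton]
      · intro x hx
        simp [fibre, graphOver, hx]
    · rw [eulerIntegral_succ_of_fibre (B := B) (c := -1), ih hB, pow_succ']
      · intro x hx
        have : fibre (bandOver B f g) x = realIoo (f x) (g x) := by
          ext t
          simp [fibre, bandOver, realIoo, hx]
        rw [this, lineEulerIntegral_Ioo (hfg x hx)]
      · intro x hx
        simp [fibre, bandOver, hx]

open Set in
theorem CellPartition.eulerChar_eq {n : ℕ} {S : Set (Fin n → ℝ)} (𝒞 : CellPartition S) :
    (𝒞.eulerChar : ℚ) = eulerIntegral n (indicator S 1) := by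
  classical
  have hS : (indicator S 1 : (Fin n → ℝ) → ℚ) = ∑ C ∈ 𝒞.cells, indicator C 1 := by
    funext x
    conv_lhs => rw [← 𝒞.union]
    erw [Finset.indicator_biUnion_apply 𝒞.cells id fun C hC C' hC' hne =>
      𝒞.disjoint C hC C' hC' hne]
    simp
  -- Group the cells by dimension; `IsCell.dim_le` ensures that no cell escapes the range `0, …, n`.
  rw [hS, map_sum, Finset.sum_congr rfl fun C hC => (𝒞.isCell C hC).eulerIntegral,
    ← Finset.sum_fiberwise_of_maps_to (t := Finset.range (n + 1)) (g := 𝒞.dim)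
      fun C hC => Finset.mem_range_succ_iff.2 (𝒞.isCell C hC).dim_le, CellPartition.eulerChar]
  push_cast
  refine Finset.sum_congr rfl fun d _ => ?_
  rw [Finset.sum_congr rfl fun C hC => by rw [(Finset.mem_filter.1 hC).2], Finset.sum_const,
    nsmul_eq_mul, mul_comm]

theorem eulerChar_eq_eulerIntegral {n : ℕ} {S : Set (Fin n → ℝ)} (h : Nonempty (CellPartition S)) :
    (eulerChar S : ℚ) = eulerIntegral n (Set.indicator S 1) := by
  rw [eulerChar, dif_pos h, CellPartition.eulerChar_eq]

theorem eulerCharWellDefined_of_nonempty {n : ℕ} {S : Set (Fin n → ℝ)}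
    (h : Nonempty (CellPartition S)) : EulerCharWellDefined S :=
  ⟨h, fun 𝒞 => by
    have := 𝒞.eulerChar_eq.trans (eulerChar_eq_eulerIntegral h).symm
    exact_mod_cast this⟩

-- The projection is again compact, convex and nonempty, and each nonempty fibre is a closed
-- interval, of Euler characteristic 1.
open Set in
theorem eulerIntegral_of_convex_compact {n : ℕ} {S : Set (Fin n → ℝ)} (hc : Convex ℝ S)
    (hk : IsCompact S) (hne : S.Nonempty) : eulerIntegral n (indicator S 1) = 1 := by
  induction n with
  | zero =>
    have : S = univ := Subsingleton.eq_univ_of_nonempty hne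
    simp [this, eulerIntegral]
  | succ n ih =>
    let π : (Fin (n + 1) → ℝ) →ₗ[ℝ] (Fin n → ℝ) := LinearMap.funLeft ℝ ℝ Fin.castSucc
    have hπ : Continuous π := π.continuous_of_finiteDimensional
    rw [eulerIntegral_succ_of_fibre (B := π '' S) (c := 1), one_mul]
    · exact ih (hc.linear_image π) (hk.image hπ) (hne.image π)
    · rintro _ ⟨p, hp, rfl⟩
      have hne' : (fibre S (π p)).Nonempty := ⟨p (Fin.last n), by
        have : (Fin.snoc (π p) (p (Fin.last n)) : Fin (n + 1) → ℝ) = p := Fin.snoc_init_self p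
        simpa [fibre, this]⟩
      have himg : fibre S (π p) = (fun q => q (Fin.last n)) '' (S ∩ π ⁻¹' {π p}) := by
        ext t
        constructor
        · intro ht
          refine ⟨_, ⟨ht, ?_⟩, by simp⟩
          funext i
          simp [π, LinearMap.funLeft_apply]
        · rintro ⟨q, ⟨hq, hqp⟩, rfl⟩
          have : (Fin.snoc (π q) (q (Fin.last n)) : Fin (n + 1) → ℝ) = q := Fin.snoc_init_self q
          rw [← show π q = π p from hqp]
          simpa [fibre, this]
      have hk' : IsCompact (fibre S (π p)) := by
        rw [himg]
        exact (hk.inter_right (isClosed_singleton.preimage hπ)).image (continuous_apply _)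
      have hc' : Convex ℝ (fibre S (π p)) := by
        rw [himg]
        exact (hc.inter ((convex_singleton _).linear_preimage π)).linear_image
          (LinearMap.proj (R := ℝ) (φ := fun _ => ℝ) (Fin.last n))
      have hconn : IsConnected (fibre S (π p)) := ⟨hne', hc'.isPreconnected⟩
      rw [eq_Icc_of_connected_compact hconn hk']
      exact lineEulerIntegral_Icc (Real.sInf_le_sSup _ hk'.bddBelow hk'.bddAbove)
    · intro x hx
      refine eq_empty_of_forall_notMem fun t ht => hx ⟨_, ht, ?_⟩
      funext i
      simp [π, LinearMap.funLeft_apply]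

open Set in
/-- The Euler integral of a union of compact convex sets depends only on the nerve. -/
theorem eulerIntegral_biUnion_congr {n : ℕ} {ι : Type*} (s : Finset ι)
    (A B : ι → Set (Fin n → ℝ)) (hA : ∀ i, Convex ℝ (A i)) (hA' : ∀ i, IsCompact (A i))
    (hB : ∀ i, Convex ℝ (B i)) (hB' : ∀ i, IsCompact (B i))
    (h : ∀ t : Finset ι, t.Nonempty → ((⋂ i ∈ t, A i).Nonempty ↔ (⋂ i ∈ t, B i).Nonempty)) :
    eulerIntegral n (indicator (⋃ i ∈ s, A i) 1) =
      eulerIntegral n (indicator (⋃ i ∈ s, B i) 1) := by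
  -- Inclusion-exclusion at the level of indicators, then linearity.
  have key : ∀ C : ι → Set (Fin n → ℝ), eulerIntegral n (indicator (⋃ i ∈ s, C i) 1) =
      ∑ t ∈ s.powerset with t.Nonempty,
        (-1 : ℤ) ^ (t.card + 1) • eulerIntegral n (indicator (⋂ i ∈ t, C i) 1) := by
    intro C
    have : (indicator (⋃ i ∈ s, C i) 1 : (Fin n → ℝ) → ℚ) = ∑ t ∈ s.powerset with t.Nonempty,
        (-1 : ℤ) ^ (t.card + 1) • indicator (⋂ i ∈ t, C i) 1 := by
      funext x
      rw [Finset.indicator_biUnion_eq_sum_powerset, Finset.sum_apply]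
      rfl
    rw [this, map_sum]
    exact Finset.sum_congr rfl fun t _ => map_zsmul _ _ _
  have val : ∀ C : ι → Set (Fin n → ℝ), (∀ i, Convex ℝ (C i)) → (∀ i, IsCompact (C i)) →
      ∀ t : Finset ι, t.Nonempty → (⋂ i ∈ t, C i).Nonempty →
        eulerIntegral n (indicator (⋂ i ∈ t, C i) 1) = 1 := by
    intro C hC hC' t ht hne
    refine eulerIntegral_of_convex_compact (convex_iInter₂ fun i _ => hC i) ?_ hne
    obtain ⟨j, hj⟩ := ht
    exact (hC' j).of_isClosed_subset (isClosed_biInter fun i _ => (hC' i).isClosed)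
      (biInter_subset_of_mem hj)
  rw [key, key]
  refine Finset.sum_congr rfl fun t ht => ?_
  have ht' := (Finset.mem_filter.1 ht).2
  by_cases hne : (⋂ i ∈ t, A i).Nonempty
  · rw [val A hA hA' t ht' hne, val B hB hB' t ht' ((h t ht').1 hne)]
  · have hne' := fun hb => hne ((h t ht').2 hb)
    rw [not_nonempty_iff_eq_empty.1 hne, not_nonempty_iff_eq_empty.1 hne']

/-! ### Sign classes of affine functions -/

theorem sign_eq_sign_iff {a b : ℝ} :
    SignType.sign a = SignType.sign b ↔ (0 < a ↔ 0 < b) ∧ (a < 0 ↔ b < 0) := by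
  rcases lt_trichotomy a 0 with h | rfl | h <;> rcases lt_trichotomy b 0 with h' | rfl | h' <;>
    simp [*, sign_pos, sign_neg, lt_asymm]

/-- The points at which the affine functions in `A` have the same signs as at `p`. -/
def signClass {n : ℕ} (A : Finset ((Fin n → ℝ) →ᵃ[ℝ] ℝ)) (p : Fin n → ℝ) : Set (Fin n → ℝ) :=
  {q | ∀ a ∈ A, SignType.sign (a q) = SignType.sign (a p)}

theorem mem_signClass_self {n : ℕ} (A : Finset ((Fin n → ℝ) →ᵃ[ℝ] ℝ)) (p : Fin n → ℝ) :
    p ∈ signClass A p := fun _ _ => rfl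

theorem signClass_eq_of_mem {n : ℕ} {A : Finset ((Fin n → ℝ) →ᵃ[ℝ] ℝ)} {p q : Fin n → ℝ}
    (h : q ∈ signClass A p) : signClass A q = signClass A p := by
  ext x
  exact forall₂_congr fun a ha => by rw [h a ha]

theorem signClass_anti {n : ℕ} {A A' : Finset ((Fin n → ℝ) →ᵃ[ℝ] ℝ)} (h : A ⊆ A')
    (p : Fin n → ℝ) : signClass A' p ⊆ signClass A p := fun _ hq a ha => hq a (h ha)

theorem finite_range_signClass {n : ℕ} (A : Finset ((Fin n → ℝ) →ᵃ[ℝ] ℝ)) :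
    (Set.range (signClass A)).Finite := by
  let F : (A → SignType) → Set (Fin n → ℝ) := fun s => {q | ∀ a : A, SignType.sign (a.1 q) = s a}
  refine (Set.finite_range F).subset ?_
  rintro _ ⟨p, rfl⟩
  refine ⟨fun a => SignType.sign (a.1 p), ?_⟩
  ext q
  exact Subtype.forall

theorem AffineMap.exists_mvPolynomial {n : ℕ} (a : (Fin n → ℝ) →ᵃ[ℝ] ℝ) :
    ∃ P : MvPolynomial (Fin n) ℝ, ∀ x, MvPolynomial.eval x P = a x := by
  refine ⟨∑ i, MvPolynomial.C (a.linear fun j => if i = j then 1 else 0) * MvPolynomial.X i +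
    MvPolynomial.C (a 0), fun x => ?_⟩
  have h := congrFun a.decomp x
  rw [h, Pi.add_apply, LinearMap.pi_apply_eq_sum_univ]
  simp [mul_comm]

namespace IsSemialgebraic

theorem univ {n : ℕ} : IsSemialgebraic (Set.univ : Set (Fin n → ℝ)) := by
  simpa using IsSemialgebraic.zero (0 : MvPolynomial (Fin n) ℝ)

theorem sign_affineMap {n : ℕ} (a : (Fin n → ℝ) →ᵃ[ℝ] ℝ) (c : ℝ) :
    IsSemialgebraic {x | SignType.sign (a x) = SignType.sign c} := by
  obtain ⟨P, hP⟩ := a.exists_mvPolynomial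
  rcases lt_trichotomy c 0 with h | rfl | h
  · simpa [hP, sign_neg h, sign_eq_neg_one_iff] using IsSemialgebraic.pos (-P)
  · simpa [hP] using IsSemialgebraic.zero P
  · simpa [hP, sign_pos h, sign_eq_one_iff] using IsSemialgebraic.pos P

theorem signClass {n : ℕ} (A : Finset ((Fin n → ℝ) →ᵃ[ℝ] ℝ)) (p : Fin n → ℝ) :
    IsSemialgebraic (signClass A p) := by
  classical
  induction A using Finset.induction_on with
  | empty => simpa [_root_.signClass] using univ
  | insert a A _ ih =>
    convert (sign_affineMap a (a p)).inter ih using 1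
    ext q
    simp [_root_.signClass]

theorem cylinder {n : ℕ} {B : Set (Fin n → ℝ)} (h : IsSemialgebraic B) :
    IsSemialgebraic {q : Fin (n + 1) → ℝ | Fin.init q ∈ B} := by
  induction h with
  | pos P =>
    convert IsSemialgebraic.pos (MvPolynomial.rename Fin.castSucc P) using 1
    ext q
    simp only [Set.mem_ofPred_eq, MvPolynomial.eval_rename]
    rfl
  | zero P =>
    convert IsSemialgebraic.zero (MvPolynomial.rename Fin.castSucc P) using 1
    ext q
    simp only [Set.mem_ofPred_eq, MvPolynomial.eval_rename]
    rfl
  | union _ _ h₁ h₂ => exact h₁.union h₂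
  | inter _ _ h₁ h₂ => exact h₁.inter h₂

end IsSemialgebraic

/-! ### Linear cell decomposition -/

/-- The projection `ℝ^{n+1} → ℝⁿ` forgetting the last coordinate. -/
def initLinear (n : ℕ) : (Fin (n + 1) → ℝ) →ₗ[ℝ] (Fin n → ℝ) :=
  LinearMap.funLeft ℝ ℝ Fin.castSucc

@[simp]
theorem initLinear_apply {n : ℕ} (q : Fin (n + 1) → ℝ) : initLinear n q = Fin.init q := rfl

/-- The embedding `ℝⁿ → ℝ^{n+1}`, `x ↦ (x, 0)`. -/
def snocZeroLinear (n : ℕ) : (Fin n → ℝ) →ₗ[ℝ] (Fin (n + 1) → ℝ) where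
  toFun x := Fin.snoc x 0
  map_add' x y := by
    funext i
    refine Fin.lastCases ?_ (fun j => ?_) i <;> simp
  map_smul' c x := by
    funext i
    refine Fin.lastCases ?_ (fun j => ?_) i <;> simp

theorem isContSemialgebraicOn_affineMap {n : ℕ} {B : Set (Fin n → ℝ)} (hB : IsSemialgebraic B)
    (f : (Fin n → ℝ) →ᵃ[ℝ] ℝ) : IsContSemialgebraicOn B f := by
  refine ⟨f.continuous_of_finiteDimensional.continuousOn, ?_⟩
  convert hB.cylinder.inter (IsSemialgebraic.sign_affineMap
    ((LinearMap.proj (R := ℝ) (φ := fun _ => ℝ) (Fin.last n)).toAffineMap -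
      f.comp (initLinear n).toAffineMap) 0) using 1
  ext q
  simp [graphOver, sub_eq_zero]

namespace AffineMap

variable {n : ℕ} (a : (Fin (n + 1) → ℝ) →ᵃ[ℝ] ℝ)

/-- The coefficient of the last coordinate in an affine function. -/
def lastCoeff : ℝ := a.linear (Pi.single (Fin.last n) 1)

/-- The part of an affine function that does not involve the last coordinate. -/
def basePart : (Fin n → ℝ) →ᵃ[ℝ] ℝ := a.comp (snocZeroLinear n).toAffineMap

/-- The zero of an affine function, as a function of all but the last coordinate. -/
noncomputable def root : (Fin n → ℝ) →ᵃ[ℝ] ℝ := (-(lastCoeff a)⁻¹) • basePart a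

theorem apply_eq_basePart (q : Fin (n + 1) → ℝ) :
    a q = basePart a (Fin.init q) + lastCoeff a * q (Fin.last n) := by
  have hq : q = q (Fin.last n) • (Pi.single (Fin.last n) 1 : Fin (n + 1) → ℝ) +ᵥ
      snocZeroLinear n (Fin.init q) := by
    funext i
    refine Fin.lastCases ?_ (fun j => ?_) i
    · simp [snocZeroLinear]
    · simp [snocZeroLinear, Fin.init]
  conv_lhs => rw [hq, a.map_vadd, map_smul]
  simp [basePart, lastCoeff]
  ring

theorem sign_apply (h : lastCoeff a ≠ 0) (q : Fin (n + 1) → ℝ) :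
    SignType.sign (a q) = SignType.sign (lastCoeff a) *
      SignType.sign (q (Fin.last n) - root a (Fin.init q)) := by
  rw [← sign_mul, apply_eq_basePart]
  congr 1
  simp [root]
  field_simp
  ring

end AffineMap

section CellOfSignClass

variable {n : ℕ} {B : Set (Fin n → ℝ)} {x₀ : Fin n → ℝ}

/-- The order at `x₀` persists on all of `B`, so the function that is largest at `x₀` is the maximum
throughout; an empty family gives `-∞`. -/
theorem exists_lowerBound (hB : IsSemialgebraic B) (L : Finset ((Fin n → ℝ) →ᵃ[ℝ] ℝ))
    (hL : ∀ ξ ∈ L, ∀ η ∈ L, ∀ x ∈ B, ξ x₀ ≤ η x₀ → ξ x ≤ η x) :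
    ∃ f : (Fin n → ℝ) → EReal, IsCellBoundOn B f ∧
      ((∀ x, f x = ⊥) ∨ ∃ ξ ∈ L, ∀ x, f x = (ξ x : ℝ)) ∧
      ∀ x ∈ B, ∀ t : ℝ, f x < t ↔ ∀ ξ ∈ L, ξ x < t := by
  rcases L.eq_empty_or_nonempty with rfl | hne
  · exact ⟨fun _ => ⊥, .inr (.inl fun _ _ => rfl), .inl fun _ => rfl, fun x _ t => by
      simp [EReal.bot_lt_coe]⟩
  · obtain ⟨ξ, hξ, hmax⟩ := L.exists_max_image (fun ξ => ξ x₀) hne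
    refine ⟨fun x => (ξ x : ℝ), .inl ⟨ξ, isContSemialgebraicOn_affineMap hB ξ, fun _ _ => rfl⟩,
      .inr ⟨ξ, hξ, fun _ => rfl⟩, fun x hx t => ?_⟩
    rw [EReal.coe_lt_coe_iff]
    exact ⟨fun h η hη => (hL η hη ξ hξ x hx (hmax η hη)).trans_lt h, fun h => h ξ hξ⟩

theorem exists_upperBound (hB : IsSemialgebraic B) (U : Finset ((Fin n → ℝ) →ᵃ[ℝ] ℝ))
    (hU : ∀ ξ ∈ U, ∀ η ∈ U, ∀ x ∈ B, ξ x₀ ≤ η x₀ → ξ x ≤ η x) :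
    ∃ f : (Fin n → ℝ) → EReal, IsCellBoundOn B f ∧
      ((∀ x, f x = ⊤) ∨ ∃ ξ ∈ U, ∀ x, f x = (ξ x : ℝ)) ∧
      ∀ x ∈ B, ∀ t : ℝ, t < f x ↔ ∀ ξ ∈ U, t < ξ x := by
  rcases U.eq_empty_or_nonempty with rfl | hne
  · exact ⟨fun _ => ⊤, .inr (.inr fun _ _ => rfl), .inl fun _ => rfl, fun x _ t => by
      simp [EReal.coe_lt_top]⟩
  · obtain ⟨ξ, hξ, hmin⟩ := U.exists_min_image (fun ξ => ξ x₀) hne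
    refine ⟨fun x => (ξ x : ℝ), .inl ⟨ξ, isContSemialgebraicOn_affineMap hB ξ, fun _ _ => rfl⟩,
      .inr ⟨ξ, hξ, fun _ => rfl⟩, fun x hx t => ?_⟩
    rw [EReal.coe_lt_coe_iff]
    exact ⟨fun h η hη => h.trans_le (hU ξ hξ η hη x hx (hmin η hη)), fun h => h ξ hξ⟩

/-- Over a cell on which the values of finitely many affine functions keep their order, the points
lying in a given position with respect to the graphs of these functions form a cell. -/
theorem isCell_of_order {d : ℕ} (hB : IsSemialgebraic B) (hd : IsCell n d B)
    (Ξ : Finset ((Fin n → ℝ) →ᵃ[ℝ] ℝ)) (t₀ : ℝ)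
    (hΞ : ∀ ξ ∈ Ξ, ∀ η ∈ Ξ, ∀ x ∈ B,
      SignType.sign (ξ x - η x) = SignType.sign (ξ x₀ - η x₀)) :
    ∃ e, IsCell (n + 1) e {q | Fin.init q ∈ B ∧ ∀ ξ ∈ Ξ,
      SignType.sign (q (Fin.last n) - ξ (Fin.init q)) = SignType.sign (t₀ - ξ x₀)} := by
  -- If the base point lies on one of the graphs, the set is that graph; otherwise it is the band
  -- between the nearest graphs below and above.
  by_cases h : ∃ ξ ∈ Ξ, t₀ = ξ x₀
  · obtain ⟨ξ, hξ, rfl⟩ := h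
    refine ⟨d, .inl ⟨B, ξ, hd, isContSemialgebraicOn_affineMap hB ξ, ?_⟩⟩
    ext q
    refine and_congr_right fun hq => ⟨fun h => ?_, fun h η hη => ?_⟩
    · simpa [sub_eq_zero] using h ξ hξ
    · rw [h]
      exact hΞ ξ hξ η hη _ hq
  · push Not at h
    have hle : ∀ ξ ∈ Ξ, ∀ η ∈ Ξ, ∀ x ∈ B, ξ x₀ ≤ η x₀ → ξ x ≤ η x := by
      intro ξ hξ η hη x hx hle
      have := (sign_eq_sign_iff.1 (hΞ ξ hξ η hη x hx)).1
      by_contra! hlt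
      linarith [this.1 (by linarith)]
    have hlt : ∀ ξ ∈ Ξ, ∀ η ∈ Ξ, ∀ x ∈ B, ξ x₀ < η x₀ → ξ x < η x := by
      intro ξ hξ η hη x hx hlt
      have := (sign_eq_sign_iff.1 (hΞ ξ hξ η hη x hx)).2
      linarith [this.2 (by linarith)]
    have hL : ∀ ξ ∈ Ξ.filter (fun ξ => ξ x₀ < t₀), ξ ∈ Ξ ∧ ξ x₀ < t₀ := fun ξ hξ =>
      Finset.mem_filter.1 hξ
    have hU : ∀ ξ ∈ Ξ.filter (fun ξ => t₀ < ξ x₀), ξ ∈ Ξ ∧ t₀ < ξ x₀ := fun ξ hξ =>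
      Finset.mem_filter.1 hξ
    obtain ⟨f, hf, hf', hft⟩ := exists_lowerBound hB (x₀ := x₀) _
      fun ξ hξ η hη => hle ξ (hL ξ hξ).1 η (hL η hη).1
    obtain ⟨g, hg, hg', hgt⟩ := exists_upperBound hB (x₀ := x₀) _
      fun ξ hξ η hη => hle ξ (hU ξ hξ).1 η (hU η hη).1
    refine ⟨d + 1, .inr ⟨d, B, f, g, rfl, hd, hf, hg, fun x hx => ?_, ?_⟩⟩
    · rcases hf' with hf' | ⟨ξ, hξ, hf'⟩ <;> rcases hg' with hg' | ⟨η, hη, hg'⟩ <;>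
        rw [hf', hg']
      · exact bot_lt_top
      · exact EReal.bot_lt_coe _
      · exact EReal.coe_lt_top _
      · exact EReal.coe_lt_coe_iff.2 (hlt ξ (hL ξ hξ).1 η (hU η hη).1 x hx
          ((hL ξ hξ).2.trans (hU η hη).2))
    · ext q
      refine and_congr_right fun hq => ?_
      rw [hft _ hq, hgt _ hq]
      constructor
      · refine fun hs => ⟨fun ξ hξ => ?_, fun ξ hξ => ?_⟩
        · linarith [(sign_eq_sign_iff.1 (hs ξ (hL ξ hξ).1)).1.2 (by linarith [(hL ξ hξ).2])]
        · linarith [(sign_eq_sign_iff.1 (hs ξ (hU ξ hξ).1)).2.2 (by linarith [(hU ξ hξ).2])]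
      · rintro ⟨h₁, h₂⟩ ξ hξ
        rcases lt_or_gt_of_ne (h ξ hξ) with hlt | hlt
        · rw [sign_neg (sub_neg.2 hlt),
            sign_neg (sub_neg.2 (h₂ ξ (Finset.mem_filter.2 ⟨hξ, hlt⟩)))]
        · rw [sign_pos (sub_pos.2 hlt),
            sign_pos (sub_pos.2 (h₁ ξ (Finset.mem_filter.2 ⟨hξ, hlt⟩)))]

end CellOfSignClass

open AffineMap in
/-- Linear cell decomposition: every finite set of affine functions can be enlarged so that all of
its sign classes are cells. -/
theorem exists_superset_isCell_signClass (n : ℕ) (A : Finset ((Fin n → ℝ) →ᵃ[ℝ] ℝ)) :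
    ∃ A', A ⊆ A' ∧ ∀ p, ∃ d, IsCell n d (signClass A' p) := by
  classical
  induction n with
  | zero =>
    exact ⟨A, subset_rfl, fun p => ⟨0, rfl,
      Subsingleton.eq_univ_of_nonempty ⟨p, mem_signClass_self A p⟩⟩⟩
  | succ n ih =>
    -- Base parts settle the signs of functions not involving the last coordinate; differences of
    -- roots fix the order of the roots over each base class. If the last coefficient vanishes,
    -- `root` is 0, and the differences involving it are harmless extras.
    obtain ⟨D, hD, hcell⟩ := ih (A.image basePart ∪
      (A ×ˢ A).image fun ab => root ab.1 - root ab.2)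
    -- Pulling back `D` confines each sign class to the cylinder over one base cell.
    refine ⟨A ∪ D.image fun b => b.comp (initLinear n).toAffineMap, Finset.subset_union_left,
      fun p => ?_⟩
    obtain ⟨d, hd⟩ := hcell (Fin.init p)
    obtain ⟨e, he⟩ := isCell_of_order (x₀ := Fin.init p) (IsSemialgebraic.signClass D _) hd
      ((A.filter fun a => lastCoeff a ≠ 0).image root) (p (Fin.last n)) (by
        intro ξ hξ η hη x hx
        obtain ⟨a, ha, rfl⟩ := Finset.mem_image.1 hξ
        obtain ⟨b, hb, rfl⟩ := Finset.mem_image.1 hη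
        exact hx _ (hD (Finset.mem_union_right _ (Finset.mem_image.2 ⟨(a, b), Finset.mem_product.2
          ⟨(Finset.mem_filter.1 ha).1, (Finset.mem_filter.1 hb).1⟩, rfl⟩))))
    refine ⟨e, ?_⟩
    convert he using 1
    ext q
    constructor
    · intro hq
      refine ⟨fun b hb => hq _ (Finset.mem_union_right _ (Finset.mem_image_of_mem _ hb)), ?_⟩
      intro ξ hξ
      obtain ⟨a, ha, rfl⟩ := Finset.mem_image.1 hξ
      obtain ⟨ha, ha0⟩ := Finset.mem_filter.1 ha
      have := hq a (Finset.mem_union_left _ ha)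
      rw [sign_apply a ha0, sign_apply a ha0] at this
      exact mul_left_cancel₀ (sign_ne_zero.2 ha0) this
    · rintro ⟨hq, hq'⟩ a ha
      rcases Finset.mem_union.1 ha with ha | ha
      · by_cases ha0 : lastCoeff a = 0
        · rw [apply_eq_basePart, apply_eq_basePart a p, ha0, zero_mul, zero_mul, add_zero, add_zero]
          exact hq _ (hD (Finset.mem_union_left _ (Finset.mem_image_of_mem _ ha)))
        · rw [sign_apply a ha0, sign_apply a ha0,
            hq' _ (Finset.mem_image_of_mem _ (Finset.mem_filter.2 ⟨ha, ha0⟩))]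
      · obtain ⟨b, hb, rfl⟩ := Finset.mem_image.1 ha
        exact hq b hb

/-! ### Semilinear sets and simplices -/

/-- A subset of `ℝⁿ` is semilinear if it is described by the signs of finitely many affine
functions. -/
def IsSemilinear {n : ℕ} (S : Set (Fin n → ℝ)) : Prop :=
  ∃ A : Finset ((Fin n → ℝ) →ᵃ[ℝ] ℝ), ∀ p ∈ S, signClass A p ⊆ S

namespace IsSemilinear

variable {n : ℕ} {S T : Set (Fin n → ℝ)}

/-- Such a set is a union of sign classes, hence of the finitely many finer classes that are cells.
-/
theorem nonempty_cellPartition (h : IsSemilinear S) : Nonempty (CellPartition S) := by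
  classical
  obtain ⟨A, hA⟩ := h
  obtain ⟨A', hAA', hcell⟩ := exists_superset_isCell_signClass n A
  have hfin : (signClass A' '' S).Finite :=
    (finite_range_signClass A').subset (Set.image_subset_range _ _)
  refine ⟨{ cells := hfin.toFinset
            dim := fun C => if h : ∃ d, IsCell n d C then h.choose else 0
            isCell := ?_
            disjoint := ?_
            union := ?_ }⟩
  · intro C hC
    obtain ⟨p, -, rfl⟩ := hfin.mem_toFinset.1 hC
    rw [dif_pos (hcell p)]
    exact (hcell p).choose_spec
  · intro C hC C' hC' hne
    obtain ⟨p, -, rfl⟩ := hfin.mem_toFinset.1 hC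
    obtain ⟨q, -, rfl⟩ := hfin.mem_toFinset.1 hC'
    refine Set.disjoint_left.2 fun x hx hx' => hne ?_
    rw [← signClass_eq_of_mem hx, signClass_eq_of_mem hx']
  · ext x
    simp only [Set.Finite.mem_toFinset, Set.mem_image, Set.iUnion_exists, Set.biUnion_and',
      Set.iUnion_iUnion_eq_right, Set.mem_iUnion, exists_prop]
    exact ⟨fun ⟨p, hp, hx⟩ => hA p hp (signClass_anti hAA' p hx),
      fun hx => ⟨x, hx, mem_signClass_self A' x⟩⟩

theorem inter (hS : IsSemilinear S) (hT : IsSemilinear T) : IsSemilinear (S ∩ T) := by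
  classical
  obtain ⟨A, hA⟩ := hS
  obtain ⟨A', hA'⟩ := hT
  exact ⟨A ∪ A', fun p hp q hq =>
    ⟨hA p hp.1 (signClass_anti Finset.subset_union_left p hq),
      hA' p hp.2 (signClass_anti Finset.subset_union_right p hq)⟩⟩

theorem union (hS : IsSemilinear S) (hT : IsSemilinear T) : IsSemilinear (S ∪ T) := by
  classical
  obtain ⟨A, hA⟩ := hS
  obtain ⟨A', hA'⟩ := hT
  exact ⟨A ∪ A', fun p hp q hq => hp.imp
    (fun hp => hA p hp (signClass_anti Finset.subset_union_left p hq))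
    (fun hp => hA' p hp (signClass_anti Finset.subset_union_right p hq))⟩

theorem iInter {ι : Type*} [Finite ι] {S : ι → Set (Fin n → ℝ)} (h : ∀ i, IsSemilinear (S i)) :
    IsSemilinear (⋂ i, S i) := by
  classical
  have := Fintype.ofFinite ι
  choose A hA using h
  refine ⟨Finset.univ.biUnion A, fun p hp q hq => Set.mem_iInter.2 fun i => ?_⟩
  exact hA i p (Set.mem_iInter.1 hp i)
    (signClass_anti (Finset.subset_biUnion_of_mem A (Finset.mem_univ i)) p hq)

theorem biUnion {ι : Type*} (s : Finset ι) {S : ι → Set (Fin n → ℝ)}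
    (h : ∀ i ∈ s, IsSemilinear (S i)) : IsSemilinear (⋃ i ∈ s, S i) := by
  classical
  induction s using Finset.induction_on with
  | empty => exact ⟨∅, by simp⟩
  | insert i s _ ih =>
    rw [Finset.set_biUnion_insert]
    exact (h i (Finset.mem_insert_self i s)).union
      (ih fun j hj => h j (Finset.mem_insert_of_mem hj))

theorem nonneg (a : (Fin n → ℝ) →ᵃ[ℝ] ℝ) : IsSemilinear {x | 0 ≤ a x} := by
  refine ⟨{a}, fun p hp q hq => ?_⟩
  have := (sign_eq_sign_iff.1 (hq a (Finset.mem_singleton_self a))).2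
  exact not_lt.1 fun h => (this.1 h).not_ge hp

theorem eq_zero (a : (Fin n → ℝ) →ᵃ[ℝ] ℝ) : IsSemilinear {x | a x = 0} := by
  convert (nonneg a).inter (nonneg (-a)) using 1
  ext x
  simp [le_antisymm_iff, and_comm]

end IsSemilinear

/-- In terms of an affine basis extending its vertices, a simplex is the set where the coordinates
of the vertices are nonnegative and all other coordinates vanish. -/
theorem AffineBasis.convexHull_image_eq {ι E : Type*} [Fintype ι] [AddCommGroup E] [Module ℝ E]
    (b : AffineBasis ι ℝ E) (s : Set ι) :
    convexHull ℝ (b '' s) = {x | ∀ i, 0 ≤ b.coord i x ∧ (i ∉ s → b.coord i x = 0)} := by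
  classical
  apply Set.Subset.antisymm
  · refine convexHull_min ?_ ?_
    · rintro _ ⟨j, hj, rfl⟩ i
      rw [b.coord_apply]
      refine ⟨by split_ifs <;> norm_num, fun hi => if_neg ?_⟩
      rintro rfl
      exact hi hj
    · intro x hx y hy u v hu hv huv i
      rw [Convex.combo_affine_apply huv]
      refine ⟨add_nonneg (mul_nonneg hu (hx i).1) (mul_nonneg hv (hy i).1), fun hi => ?_⟩
      rw [(hx i).2 hi, (hy i).2 hi]
      simp
  · intro x hx
    rw [← b.linear_combination_coord_eq_self x,
      ← Finset.sum_filter_of_ne (p := (· ∈ s)) fun i _ hi => ?_]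
    · refine (convex_convexHull ℝ _).sum_mem (fun i _ => (hx i).1) ?_
        fun i hi => subset_convexHull ℝ _ ⟨i, (Finset.mem_filter.1 hi).2, rfl⟩
      rw [Finset.sum_filter_of_ne fun i _ hi => ?_, b.sum_coord_apply_eq_one]
      by_contra his
      exact hi ((hx i).2 his)
    · by_contra his
      exact hi (by rw [(hx i).2 his, zero_smul])

/-- After extending the vertices to an affine basis, barycentric coordinates are affine functions on
the whole space whose signs cut out the simplex. -/
theorem isSemilinear_convexHull {n : ℕ} {s : Finset (Euc n)}
    (hs : AffineIndependent ℝ ((↑) : s → Euc n)) :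
    IsSemilinear {x | (WithLp.toLp 2 x : Euc n) ∈ convexHull ℝ (s : Set (Euc n))} := by
  obtain ⟨t, hst, hind, htop⟩ := exists_subset_affineIndependent_affineSpan_eq_top hs
  have : Fintype t := (finite_set_of_fin_dim_affineIndependent ℝ hind).fintype
  let b : AffineBasis t ℝ (Euc n) := ⟨(↑), hind, by simpa using htop⟩
  have hsb : (s : Set (Euc n)) = b '' {i | (i : Euc n) ∈ s} := by
    ext x
    constructor
    · exact fun hx => ⟨⟨x, hst hx⟩, hx, rfl⟩
    · rintro ⟨i, hi, rfl⟩
      exact hi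
  let ψ : (Fin n → ℝ) →ᵃ[ℝ] Euc n := (WithLp.linearEquiv 2 ℝ (Fin n → ℝ)).symm.toLinearMap.toAffineMap
  have h : IsSemilinear (⋂ i : t, {x | 0 ≤ (b.coord i).comp ψ x} ∩
      {x | (i : Euc n) ∉ s → (b.coord i).comp ψ x = 0}) := by
    refine IsSemilinear.iInter fun i => (IsSemilinear.nonneg _).inter ?_
    by_cases hi : (i : Euc n) ∈ s
    · exact ⟨∅, fun p _ q _ hq => absurd hi hq⟩
    · simpa [hi] using IsSemilinear.eq_zero ((b.coord i).comp ψ)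
  convert h using 1
  rw [hsb, b.convexHull_image_eq]
  ext x
  simp only [Set.mem_iInter]
  rfl

/-! ### Sublevel sets and Euler curves -/

namespace EmbeddedComplex

variable {n : ℕ}

/-- The part of a simplex with vertex set `s` lying in a half-space. -/
def simplexSublevel (s : Finset (Euc n)) (v : Euc n) (r : ℝ) : Set (Euc n) :=
  convexHull ℝ (s : Set (Euc n)) ∩ {x | inner ℝ x v ≤ r}

theorem isCompact_simplexSublevel (s : Finset (Euc n)) (v : Euc n) (r : ℝ) :
    IsCompact (simplexSublevel s v r) :=
  (s.finite_toSet.isCompact_convexHull ℝ).inter_right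
    (isClosed_le (continuous_id.inner continuous_const) continuous_const)

theorem convex_simplexSublevel (s : Finset (Euc n)) (v : Euc n) (r : ℝ) :
    Convex ℝ (simplexSublevel s v r) := by
  refine (convex_convexHull ℝ _).inter (convex_halfSpace_le ⟨fun x y => ?_, fun c x => ?_⟩ r)
  · exact inner_add_left x y v
  · exact real_inner_smul_left x v c

theorem sublevel_eq_biUnion (K : EmbeddedComplex n) (v : UnitSphere n) (r : ℝ) :
    K.sublevel v r =
      ⋃ s ∈ K.finite_faces.toFinset, WithLp.toLp 2 ⁻¹' simplexSublevel s (v : Euc n) r := by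
  ext x
  simp only [sublevel, carrier, Geometry.SimplicialComplex.mem_space_iff, simplexSublevel,
    Set.mem_iUnion, Set.Finite.mem_toFinset, exists_prop, Set.mem_preimage, Set.mem_inter_iff,
    Set.mem_ofPred_eq]
  grind

theorem isSemilinear_sublevel (K : EmbeddedComplex n) (v : UnitSphere n) (r : ℝ) :
    IsSemilinear (K.sublevel v r) := by
  rw [sublevel_eq_biUnion]
  refine IsSemilinear.biUnion _ fun s hs =>
    (isSemilinear_convexHull (K.indep (K.finite_faces.mem_toFinset.1 hs))).inter ?_
  let a : (Fin n → ℝ) →ᵃ[ℝ] ℝ := AffineMap.const ℝ _ r - ((innerₛₗ ℝ (v : Euc n)) ∘ₗ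
    (WithLp.linearEquiv 2 ℝ (Fin n → ℝ)).symm.toLinearMap).toAffineMap
  have ha : (WithLp.toLp 2 ⁻¹' {x : Euc n | inner ℝ x (v : Euc n) ≤ r} : Set (Fin n → ℝ)) =
      {x | 0 ≤ a x} := by
    ext x
    simp [a, real_inner_comm]
  change IsSemilinear (WithLp.toLp 2 ⁻¹' {x : Euc n | inner ℝ x (v : Euc n) ≤ r})
  rw [ha]
  exact IsSemilinear.nonneg a

theorem eulerCharWellDefined_sublevel (K : EmbeddedComplex n) (v : UnitSphere n) (r : ℝ) :
    EulerCharWellDefined (K.sublevel v r) :=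
  eulerCharWellDefined_of_nonempty (K.isSemilinear_sublevel v r).nonempty_cellPartition

theorem eulerChar_sublevel (K : EmbeddedComplex n) (v : UnitSphere n) (r : ℝ) :
    (eulerChar (K.sublevel v r) : ℚ) = eulerIntegral n (Set.indicator
      (⋃ s ∈ K.finite_faces.toFinset, WithLp.toLp 2 ⁻¹' simplexSublevel s (v : Euc n) r) 1) := by
  rw [eulerChar_eq_eulerIntegral (K.eulerCharWellDefined_sublevel v r).1, sublevel_eq_biUnion]

theorem IsSubdivision.carrier_eq {K K' : EmbeddedComplex n} (h : K'.IsSubdivision K) :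
    K'.carrier = K.carrier := by
  ext x
  simp only [carrier, Geometry.SimplicialComplex.mem_space_iff]
  constructor
  · rintro ⟨s, hs, hx⟩
    obtain ⟨t, ht, hst⟩ := h.1 s hs
    exact ⟨t, ht, hst hx⟩
  · rintro ⟨t, ht, hx⟩
    obtain ⟨A, hA, htA⟩ := h.2 t ht
    rw [htA] at hx
    obtain ⟨s, hs, hx⟩ := Set.mem_iUnion₂.1 hx
    exact ⟨s, hA hs, hx⟩

theorem IsSubdivision.curveFeatures_eq {m : ℕ} (D : Fin m → (ℝ → ℝ) → ℝ) {K K' : EmbeddedComplex n}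
    (h : K'.IsSubdivision K) : K'.curveFeatures D = K.curveFeatures D := by
  have hs : K'.sublevel = K.sublevel := by
    unfold sublevel
    rw [h.carrier_eq]
  unfold curveFeatures eulerCurve
  rw [hs]

theorem simplexSublevel_image [DecidableEq (Euc n)] {f : Euc n → Euc n} (hf : Isometry f)
    (s : Finset (Euc n)) {v w : Euc n} {c : ℝ} (h : ∀ x, inner ℝ (f x) v = inner ℝ x w + c)
    (r : ℝ) : simplexSublevel (s.image f) v (r + c) = f '' simplexSublevel s w r := by
  have hpre : {x : Euc n | inner ℝ x w ≤ r} = f ⁻¹' {y | inner ℝ y v ≤ r + c} := by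
    ext x
    simp [h]
  rw [simplexSublevel, simplexSublevel, Finset.coe_image, ← image_convexHull_of_isometry hf, hpre,
    Set.image_inter_preimage]

/-- If the height function in direction `v` on `f(K)` is, up to a constant, the height function in
direction `w` on `K`, then so are the Euler curves. -/
theorem eulerCurve_isometryImage (K : EmbeddedComplex n) {f : Euc n → Euc n} (hf : Isometry f)
    {v w : UnitSphere n} {c : ℝ}
    (h : ∀ x, inner ℝ (f x) (v : Euc n) = inner ℝ x (w : Euc n) + c) (r : ℝ) :
    K.eulerCurve w r = (K.isometryImage f hf).eulerCurve v (r + c) := by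
  classical
  have hfaces : (K.isometryImage f hf).finite_faces.toFinset =
      K.finite_faces.toFinset.image fun s => s.image f := by
    ext s
    simp only [Set.Finite.mem_toFinset, Finset.mem_image, isometryImage, Set.mem_image]
  have hcont : Continuous (WithLp.ofLp : Euc n → Fin n → ℝ) :=
    PiLp.continuous_ofLp 2 _
  have hpre : ∀ S : Set (Euc n), (WithLp.toLp 2 ⁻¹' S : Set (Fin n → ℝ)) =
      (WithLp.linearEquiv 2 ℝ (Fin n → ℝ)).toLinearMap '' S := fun S =>
    ((WithLp.linearEquiv 2 ℝ (Fin n → ℝ)).toEquiv.image_eq_preimage_symm S).symm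
  have hcompact : ∀ S : Set (Euc n), IsCompact S →
      IsCompact (WithLp.toLp 2 ⁻¹' S : Set (Fin n → ℝ)) := fun S hS => by
    rw [hpre]
    exact hS.image hcont
  have hconvex : ∀ S : Set (Euc n), Convex ℝ S →
      Convex ℝ (WithLp.toLp 2 ⁻¹' S : Set (Fin n → ℝ)) := fun S hS => by
    rw [hpre]
    exact hS.linear_image _
  have hnonempty : ∀ S : Set (Euc n),
      (WithLp.toLp 2 ⁻¹' S : Set (Fin n → ℝ)).Nonempty ↔ S.Nonempty := fun S => by
    rw [hpre, Set.image_nonempty]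
  have key : (eulerChar (K.sublevel w r) : ℚ) =
      eulerChar ((K.isometryImage f hf).sublevel v (r + c)) := by
    -- Both unions are now indexed by the faces of `K`, so their nerves can be compared.
    rw [eulerChar_sublevel, eulerChar_sublevel, hfaces, Finset.set_biUnion_finset_image]
    refine eulerIntegral_biUnion_congr _ _ _ (fun s => hconvex _ (convex_simplexSublevel _ _ _))
      (fun s => hcompact _ (isCompact_simplexSublevel _ _ _))
      (fun s => hconvex _ (convex_simplexSublevel _ _ _))
      (fun s => hcompact _ (isCompact_simplexSublevel _ _ _)) fun t ht => ?_
    simp only [simplexSublevel_image hf _ h, ← Set.preimage_iInter₂, hnonempty]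
    -- An injective image commutes with intersections over the nonempty index set `t`.
    rw [← hf.injective.injOn.image_biInter_eq ht, Set.image_nonempty]
  have key' : eulerChar (K.sublevel w r) = eulerChar ((K.isometryImage f hf).sublevel v (r + c)) := by
    exact_mod_cast key
  rw [eulerCurve, eulerCurve, key']

end EmbeddedComplex

/-! ### Isometries and the orthogonal action -/

/-- Every linear isometry of `ℝⁿ` acts on the sphere as an orthogonal matrix. -/
theorem exists_orthogonalSphereMap_eq {n : ℕ} (U : Euc n ≃ₗᵢ[ℝ] Euc n) :
    ∃ Q : Matrix.orthogonalGroup (Fin n) ℝ, ∀ x : UnitSphere n,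
      (orthogonalSphereMap Q x : Euc n) = U x := by
  let u : unitary (Euc n →L[ℝ] Euc n) := Unitary.linearIsometryEquiv.symm U
  let Φ := Matrix.toEuclideanCLM (n := Fin n) (𝕜 := ℝ)
  refine ⟨⟨Φ.symm u, Unitary.map_mem Φ.symm u.2⟩, fun x => ?_⟩
  have h : Φ (Φ.symm (u : Euc n →L[ℝ] Euc n)) x = u.1 x := by rw [Φ.apply_symm_apply]
  exact h

/-- The matrix `Q` is the inverse of the linear part of `f`; the translation part only shifts each
Euler curve, by `⟨f 0, v⟩`, which the functionals do not see. -/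
theorem EmbeddedComplex.exists_curveFeatures_isometryImage {n m : ℕ} (D : Fin m → (ℝ → ℝ) → ℝ)
    (hD : ∀ i, IsTranslationInvariant (D i)) (K : EmbeddedComplex n) (f : Euc n → Euc n)
    (hf : Isometry f) : ∃ Q : Matrix.orthogonalGroup (Fin n) ℝ,
      (K.isometryImage f hf).curveFeatures D =
        fun v => K.curveFeatures D (orthogonalSphereMap Q v) := by
  let F := hf.affineIsometryOfStrictConvexSpace
  let U : Euc n ≃ₗᵢ[ℝ] Euc n := F.linearIsometry.toLinearIsometryEquiv rfl
  obtain ⟨Q, hQ⟩ := exists_orthogonalSphereMap_eq U.symm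
  refine ⟨Q, ?_⟩
  funext v i
  have hx : ∀ x, inner ℝ (f x) (v : Euc n) =
      inner ℝ x (orthogonalSphereMap Q v : Euc n) + inner ℝ (f 0) (v : Euc n) := by
    intro x
    have hfx : f x = U x + f 0 := by
      have := F.map_vadd 0 x
      rw [vadd_eq_add, add_zero] at this
      exact this
    rw [hfx, inner_add_left, hQ, ← U.inner_map_map x, U.apply_symm_apply]
  exact (hD i _ _ _ fun r => K.eulerCurve_isometryImage hf hx r).symm

theorem mainTheorem2 (n m k : ℕ) (D : Fin m → (ℝ → ℝ) → ℝ)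
    (hD : ∀ i, IsTranslationInvariant (D i))
    (P : (UnitSphere n → (Fin m → ℝ)) → (Fin k → ℝ))
    (hP : IsOrthogonalInvariant P) :
    (∀ (K : EmbeddedComplex n) (v : UnitSphere n) (r : ℝ),
      EulerCharWellDefined (K.sublevel v r)) ∧
    IsIsometryInvariant (fun K : EmbeddedComplex n => P (K.curveFeatures D)) ∧
    IsSubdivisionInvariant (fun K : EmbeddedComplex n => P (K.curveFeatures D)) := by
  refine ⟨fun K v r => K.eulerCharWellDefined_sublevel v r, fun K f hf => ?_, fun K K' h => ?_⟩
  · obtain ⟨Q, hQ⟩ := K.exists_curveFeatures_isometryImage D hD f hf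
    change P _ = P _
    rw [hQ, hP Q]
  · change P _ = P _
    rw [h.curveFeatures_eq]
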